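/- Let $p$ be a prime, let $k$ be an algebraically closed field of characteristic $p$, and let $P$ be a finite $p$-group. A finite-dimensional $k$-algebra $A$ is called symmetric if $A\cong\operatorname{Hom}_k(A,k)$ as $(A,A)$-bimodules. Then every finitely generated indecomposable $kP$-module $M$ whose endomorphism algebra $\operatorname{End}_{kP}(M)$ is symmetric satisfies $\dim_k M\le |P|$. Moreover, if $P$ is not cyclic, then there are infinitely many pairwise non-isomorphic finitely generated indecomposable $kP$-modules with symmetric endomorphism algebra. -/

import Mathlib

universe u v w

/-- A `k`-algebra `A` (with `k` a field) is *symmetric* if it is finite dimensional and `A` is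
isomorphic to its dual `Hom_k(A, k)` as an `(A, A)`-bimodule. Here the bimodule structure of the
dual is `(a • f • b) y = f (b * y * a)`. -/
def IsSymmetricAlg (k : Type u) (A : Type v) [Field k] [Ring A] [Algebra k A] : Prop :=
  Module.Finite k A ∧
    ∃ φ : A ≃ₗ[k] Module.Dual k A, ∀ a b x y : A, φ (a * x * b) y = φ x (b * y * a)

/-- A module is *indecomposable* if it is nonzero and is not the direct sum of two nonzero
submodules. -/
def IsIndecomposableModule (R : Type u) (M : Type v) [Ring R] [AddCommGroup M] [Module R M] :
    Prop :=
  Nontrivial M ∧ ∀ N₁ N₂ : Submodule R M, IsCompl N₁ N₂ → N₁ = ⊥ ∨ N₂ = ⊥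

/-- The finitely generated indecomposable `kG`-modules whose endomorphism algebra `End_{kG}(M)`
is a symmetric `k`-algebra. (The `k`-action on `M` is the one induced from `kG`, by the
scalar tower hypothesis.) -/
structure IsIndecWithSymmetricEnd (k : Type u) (G : Type v) (M : Type w) [Field k] [Group G]
    [AddCommGroup M] [Module k M] [Module (MonoidAlgebra k G) M]
    [IsScalarTower k (MonoidAlgebra k G) M] : Prop where
  finite : Module.Finite (MonoidAlgebra k G) M
  indecomposable : IsIndecomposableModule (MonoidAlgebra k G) M
  symmetric_end : IsSymmetricAlg k (Module.End (MonoidAlgebra k G) M)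

/-! Bound: `E = End(M)` is local, so some nonzero `P`-fixed `v` is killed by every non-injective
endomorphism, and `E` acts on `v` by scalars. For an invariant functional `f`, the rank one map `r =
f ⊗ v` satisfies `a * r = c • r`, where `a v = c • v`. Hence `φ r a = φ 1 (a * r) = c * φ 1 r`, and
`φ 1 r = 0` forces `f = 0`: the invariant functionals form a line. As every proper submodule is
killed by a nonzero one, `M` is cyclic, a quotient of `kP`. Infinitely many modules: a nonzero
character `θ : P → k` gives a unipotent plane with endomorphism algebra `k[ε]/(ε²)`, and isomorphic
planes have proportional characters. A noncyclic `P` has two independent characters, hence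
infinitely many lines of them. -/

/-! ### Fixed vectors and Fitting's lemma -/

/-- A nonzero representation of a finite `p`-group in characteristic `p` has a nonzero fixed
vector. -/
theorem IsPGroup.exists_ne_zero_fixed {p : ℕ} [Fact p.Prime] {k : Type*} [Field k] [CharP k p]
    {P : Type*} [Group P] [Finite P] (hP : IsPGroup p P) {V : Type*} [AddCommGroup V] [Module k V]
    [Nontrivial V] (ρ : Representation k P V) : ∃ v ≠ 0, ∀ g, ρ g v = v := by
  obtain ⟨v, hv⟩ := exists_ne (0 : V)
  -- As `k` may be infinite, fixed points are counted modulo `p` in the finite `𝔽_p`-span of one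
  -- orbit.
  let _ : Module (ZMod p) V := Module.compHom V (ZMod.castHom (dvd_refl p) k)
  let S : Submodule (ZMod p) V := Submodule.span (ZMod p) (Set.range fun g => ρ g v)
  have hsmul (g : P) (c : ZMod p) (x : V) : ρ g (c • x) = c • ρ g x :=
    map_smul (ρ g) (ZMod.castHom (dvd_refl p) k c) x
  have hS (g : P) (x : V) (hx : x ∈ S) : ρ g x ∈ S := by
    induction hx using Submodule.span_induction with
    | mem x hx =>
      obtain ⟨h, rfl⟩ := hx
      exact Submodule.subset_span ⟨g * h, by simp⟩
    | zero => simp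
    | add x y _ _ hx hy => simpa using S.add_mem hx hy
    | smul c x _ hx => simpa [hsmul] using S.smul_mem c hx
  let _ : MulAction P S :=
    { smul := fun g x => ⟨ρ g x, hS g x x.2⟩
      one_smul := fun x => Subtype.ext (by change ρ 1 (x : V) = x; simp)
      mul_smul := fun g h x => Subtype.ext (by change ρ (g * h) (x : V) = ρ g (ρ h x); simp) }
  have : Module.Finite (ZMod p) S := Module.Finite.span_of_finite _ (Set.finite_range _)
  have : Finite S := Module.finite_of_finite (ZMod p)
  have hvS : v ∈ S := Submodule.subset_span ⟨1, by simp⟩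
  have hcard : p ∣ Nat.card S := by
    have h1 : addOrderOf (⟨v, hvS⟩ : S) = p := by
      apply addOrderOf_eq_prime
      · rw [← Nat.cast_smul_eq_nsmul (ZMod p)]; simp
      · simpa [Subtype.ext_iff] using hv
    exact h1.symm.dvd.trans (addOrderOf_dvd_natCard _)
  obtain ⟨b, hb, hb0⟩ := hP.exists_fixed_point_of_prime_dvd_card_of_fixed_point S hcard
    (a := 0) (fun g => Subtype.ext (by change ρ g 0 = 0; simp))
  refine ⟨b, fun h => hb0 (Subtype.ext h.symm), fun g => ?_⟩
  exact congrArg Subtype.val (hb g)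

/-- An endomorphism of an indecomposable module of finite length is nilpotent or injective. -/
theorem IsIndecomposableModule.isNilpotent_or_injective {R : Type*} {M : Type*} [Ring R]
    [AddCommGroup M] [Module R M] [IsArtinian R M] [IsNoetherian R M]
    (h : IsIndecomposableModule R M) (f : Module.End R M) :
    IsNilpotent f ∨ Function.Injective f := by
  obtain ⟨n, hn⟩ := Filter.eventually_atTop.mp (LinearMap.eventually_isCompl_ker_pow_range_pow f)
  -- A positive exponent lets injectivity of the power pass to `f`.
  have hc := hn (n + 1) n.le_succ
  rcases h.2 _ _ hc with h0 | h0
  · right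
    have := LinearMap.ker_eq_bot.mp h0
    rw [pow_succ, Module.End.mul_eq_comp, LinearMap.coe_comp] at this
    exact this.of_comp
  · left
    exact ⟨n + 1, LinearMap.range_eq_bot.mp h0⟩

/-- In an indecomposable module of finite length, every nonzero submodule over the endomorphism
ring that is Artinian over it contains a nonzero vector killed by all non-injective
endomorphisms. -/
theorem IsIndecomposableModule.exists_mem_forall_apply_eq_zero {R : Type*} {M : Type*} [Ring R]
    [AddCommGroup M] [Module R M] [IsArtinian R M] [IsNoetherian R M]
    [IsArtinian (Module.End R M) M] (h : IsIndecomposableModule R M)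
    {W : Submodule (Module.End R M) M} (hW : W ≠ ⊥) :
    ∃ v ∈ W, v ≠ 0 ∧ ∀ f : Module.End R M, ¬ Function.Injective f → f v = 0 := by
  obtain ⟨S, hS, hSW⟩ := (eq_bot_or_exists_atom_le W).resolve_left hW
  obtain ⟨v, hvS, hv⟩ := S.exists_mem_ne_zero_of_ne_bot hS.1
  refine ⟨v, hSW hvS, hv, fun f hf => ?_⟩
  by_contra hfv
  -- `S` is simple over the endomorphism ring, so `f v ≠ 0` gives `a` with `a (f v) = v`; then `a *
  -- f` is not nilpotent.
  have hspan : Submodule.span (Module.End R M) {f v} = S := by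
    refine (hS.le_iff.mp ?_).resolve_left (by simpa using hfv)
    rw [Submodule.span_singleton_le_iff_mem]
    exact S.smul_mem f hvS
  obtain ⟨a, ha⟩ := Submodule.mem_span_singleton.mp (hspan ▸ hvS)
  have hav : (a * f) v = v := ha
  rcases h.isNilpotent_or_injective (a * f) with ⟨n, hn⟩ | hinj
  · have hpow : ∀ m : ℕ, ((a * f) ^ m) v = v := fun m => by
      induction m with
      | zero => simp
      | succ m ih => rw [pow_succ, Module.End.mul_apply, hav, ih]
    have := hpow n
    rw [hn] at this
    exact hv (by simpa using this.symm)
  · exact hf (Function.Injective.of_comp hinj)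

/-! ### Invariant functionals and cyclicity -/

section InvariantFunctional

variable {k : Type*} [Field k] {G : Type*} [Group G] {M : Type*} [AddCommGroup M] [Module k M]
  [Module (MonoidAlgebra k G) M] [IsScalarTower k (MonoidAlgebra k G) M]

/-- The rank one endomorphism `m ↦ f m • v` attached to a fixed vector `v` and an invariant
functional `f`. -/
noncomputable def rankOneEnd (f : Module.Dual k M) (v : M)
    (hf : ∀ (g : G) (m : M), f (MonoidAlgebra.single g (1 : k) • m) = f m)
    (hv : ∀ g : G, MonoidAlgebra.single g (1 : k) • v = v) : Module.End (MonoidAlgebra k G) M :=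
  MonoidAlgebra.equivariantOfLinearOfComm (f.smulRight v) fun g m => by
    rw [LinearMap.smulRight_apply, LinearMap.smulRight_apply, hf, smul_comm, hv]

theorem rankOneEnd_apply (f : Module.Dual k M) (v : M)
    (hf : ∀ (g : G) (m : M), f (MonoidAlgebra.single g (1 : k) • m) = f m)
    (hv : ∀ g : G, MonoidAlgebra.single g (1 : k) • v = v) (m : M) :
    rankOneEnd f v hf hv m = f m • v := rfl

/-- If a submodule of a representation of a finite `p`-group in characteristic `p` is proper,
there is a nonzero invariant functional vanishing on it. -/
theorem IsPGroup.exists_invariant_functional {p : ℕ} [Fact p.Prime] [CharP k p] [Finite G]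
    (hG : IsPGroup p G) {N : Submodule (MonoidAlgebra k G) M} (hN : N ≠ ⊤) :
    ∃ f : Module.Dual k M, f ≠ 0 ∧ (∀ n ∈ N, f n = 0) ∧
      ∀ (g : G) (m : M), f (MonoidAlgebra.single g (1 : k) • m) = f m := by
  have hN' : N.restrictScalars k ≠ ⊤ := fun h => hN (by simpa using h)
  have : Nontrivial (M ⧸ N.restrictScalars k) := Submodule.Quotient.nontrivial_iff.mpr hN'
  have hρ (g : G) (m : M) : Representation.ofModule' (k := k) (G := G) M g m =
      MonoidAlgebra.single g (1 : k) • m := rfl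
  let ρ := (Representation.ofModule' (k := k) (G := G) M).quotient (N.restrictScalars k)
    fun g m hm => N.smul_mem _ hm
  obtain ⟨f, hf, hfix⟩ := hG.exists_ne_zero_fixed ρ.dual
  refine ⟨f ∘ₗ (N.restrictScalars k).mkQ, ?_, ?_, ?_⟩
  · intro h
    refine hf (LinearMap.ext fun x => ?_)
    obtain ⟨m, rfl⟩ := Submodule.mkQ_surjective _ x
    exact LinearMap.congr_fun h m
  · intro n hn
    have : (N.restrictScalars k).mkQ n = 0 := by simpa using hn
    simp [this]
  · intro g m
    have := LinearMap.congr_fun (hfix g⁻¹) ((N.restrictScalars k).mkQ m)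
    rw [Representation.dual_apply, Module.Dual.transpose_apply, inv_inv] at this
    exact this

end InvariantFunctional

/-- An indecomposable module with symmetric endomorphism algebra over the group algebra of a finite
`p`-group in characteristic `p` is cyclic. -/
theorem IsIndecWithSymmetricEnd.exists_span_singleton_eq_top {p : ℕ} [Fact p.Prime] {k : Type*}
    [Field k] [IsAlgClosed k] [CharP k p] {P : Type*} [Group P] [Finite P] (hP : IsPGroup p P)
    {M : Type*} [AddCommGroup M] [Module k M] [Module (MonoidAlgebra k P) M]
    [IsScalarTower k (MonoidAlgebra k P) M] (h : IsIndecWithSymmetricEnd k P M) :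
    ∃ m : M, Submodule.span (MonoidAlgebra k P) {m} = ⊤ := by
  have := h.finite
  have : Module.Finite k (MonoidAlgebra k P) := .equiv (MonoidAlgebra.coeffLinearEquiv k).symm
  have hfin : Module.Finite k M := .trans (MonoidAlgebra k P) M
  have : IsArtinian (MonoidAlgebra k P) M := isArtinian_of_tower k inferInstance
  have : IsNoetherian (MonoidAlgebra k P) M := isNoetherian_of_tower k inferInstance
  have : IsScalarTower k (Module.End (MonoidAlgebra k P) M) M := ⟨fun _ _ _ => rfl⟩
  have : IsArtinian (Module.End (MonoidAlgebra k P) M) M := isArtinian_of_tower k inferInstance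
  have : Nontrivial M := h.indecomposable.1
  obtain ⟨-, φ, hφ⟩ := h.symmetric_end
  -- a fixed vector that is an eigenvector of all endomorphisms
  let W : Submodule (Module.End (MonoidAlgebra k P) M) M :=
    { carrier := {v | ∀ g : P, MonoidAlgebra.single g (1 : k) • v = v}
      add_mem' := fun {a b} ha hb g => by rw [smul_add, ha g, hb g]
      zero_mem' := fun g => smul_zero _
      smul_mem' := fun f v hv g => by
        rw [Module.End.smul_def, ← map_smul, hv g] }
  have hW : W ≠ ⊥ := by
    obtain ⟨v, hv, hfix⟩ := hP.exists_ne_zero_fixed (Representation.ofModule' (k := k) (G := P) M)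
    exact (Submodule.ne_bot_iff _).mpr ⟨v, hfix, hv⟩
  obtain ⟨v, hvW, hv, hkill⟩ := h.indecomposable.exists_mem_forall_apply_eq_zero hW
  have heig (a : Module.End (MonoidAlgebra k P) M) : ∃ c : k, a v = c • v := by
    obtain ⟨c, hc⟩ := Module.End.exists_eigenvalue (a.restrictScalars k)
    obtain ⟨x, hx⟩ := hc.exists_hasEigenvector
    have hx' : a x = c • x := hx.apply_eq_smul
    refine ⟨c, ?_⟩
    have := hkill (a - algebraMap k _ c) fun hinj => hx.2 <| hinj <| by
      rw [LinearMap.sub_apply, Module.algebraMap_end_apply, hx', sub_self, map_zero]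
    rwa [LinearMap.sub_apply, Module.algebraMap_end_apply, sub_eq_zero] at this
  obtain ⟨f₀, hf₀, -, hinv₀⟩ := hP.exists_invariant_functional (k := k) (M := M) bot_ne_top
  obtain ⟨m₀, hm₀⟩ : ∃ m, f₀ m ≠ 0 := by
    by_contra! hc
    exact hf₀ (LinearMap.ext hc)
  refine ⟨m₀, by_contra fun htop => ?_⟩
  obtain ⟨f₁, hf₁, hvan, hinv₁⟩ := hP.exists_invariant_functional htop
  have hf₁m : f₁ m₀ = 0 := hvan _ (Submodule.mem_span_singleton_self m₀)
  -- some nontrivial combination of the two functionals has symmetrizing value zero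
  have key (f : Module.Dual k M)
      (hf : ∀ (g : P) (m : M), f (MonoidAlgebra.single g (1 : k) • m) = f m)
      (hz : φ 1 (rankOneEnd f v hf hvW) = 0) : f = 0 := by
    have hzero : φ (rankOneEnd f v hf hvW) = 0 := by
      ext a
      obtain ⟨c, hc⟩ := heig a
      have hmul : a * rankOneEnd f v hf hvW = c • rankOneEnd f v hf hvW := by
        ext m
        rw [Module.End.mul_apply, LinearMap.smul_apply, rankOneEnd_apply, ← smul_comm, ← hc,
          ← algebraMap_smul (MonoidAlgebra k P) (f m) v, map_smul, algebraMap_smul]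
      have := hφ (rankOneEnd f v hf hvW) 1 1 a
      rw [mul_one, mul_one, one_mul, hmul, map_smul, hz, smul_zero] at this
      simpa using this
    have h0 : rankOneEnd f v hf hvW = 0 := by simpa using hzero
    ext m
    have := LinearMap.congr_fun h0 m
    rw [rankOneEnd_apply] at this
    simpa [hv] using this
  set s := φ 1 (rankOneEnd f₀ v hinv₀ hvW) with hs
  set t := φ 1 (rankOneEnd f₁ v hinv₁ hvW) with ht
  have ht0 : t ≠ 0 := fun h0 => hf₁ (key f₁ hinv₁ h0)
  have hcomb : t • f₀ - s • f₁ = 0 := by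
    have hinv : ∀ (g : P) (m : M), (t • f₀ - s • f₁) (MonoidAlgebra.single g (1 : k) • m) =
        (t • f₀ - s • f₁) m := fun g m => by
      simp [hinv₀ g m, hinv₁ g m]
    refine key _ hinv ?_
    have : rankOneEnd (t • f₀ - s • f₁) v hinv hvW =
        t • rankOneEnd f₀ v hinv₀ hvW - s • rankOneEnd f₁ v hinv₁ hvW := by
      ext m
      simp only [rankOneEnd_apply, LinearMap.sub_apply, LinearMap.smul_apply, sub_smul, smul_assoc]
    rw [this, map_sub, map_smul, map_smul, ← hs, ← ht, smul_eq_mul, smul_eq_mul, mul_comm, sub_self]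
  have := LinearMap.congr_fun hcomb m₀
  simp [hf₁m, ht0, hm₀] at this

theorem IsIndecWithSymmetricEnd.rank_le {p : ℕ} [Fact p.Prime] {k : Type*}
    [Field k] [IsAlgClosed k] [CharP k p] {P : Type*} [Group P] [Finite P] (hP : IsPGroup p P)
    {M : Type*} [AddCommGroup M] [Module k M] [Module (MonoidAlgebra k P) M]
    [IsScalarTower k (MonoidAlgebra k P) M] (h : IsIndecWithSymmetricEnd k P M) :
    Module.rank k M ≤ Nat.card P := by
  obtain ⟨m, hm⟩ := h.exists_span_singleton_eq_top hP
  have : Module.Finite k (MonoidAlgebra k P) := .equiv (MonoidAlgebra.coeffLinearEquiv k).symm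
  let F : MonoidAlgebra k P →ₗ[k] M := (LinearMap.toSpanSingleton _ M m).restrictScalars k
  have hF : Function.Surjective F := by
    have := LinearMap.range_toSpanSingleton (R := MonoidAlgebra k P) m
    rw [hm] at this
    exact fun x => LinearMap.range_eq_top.mp this x
  have : Module.Finite k M := .of_surjective F hF
  rw [← Module.finrank_eq_rank, Nat.cast_le]
  refine (LinearMap.finrank_le_finrank_of_surjective hF).trans ?_
  have := Fintype.ofFinite P
  rw [(MonoidAlgebra.coeffLinearEquiv k).finrank_eq, Module.finrank_finsupp_self,
    Nat.card_eq_fintype_card]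

/-! ### Characters of noncyclic `p`-groups -/

/-- A maximal subgroup of a finite `p`-group is the kernel of a homomorphism to `ℤ/p`. -/
theorem IsPGroup.exists_ker_eq_of_isCoatom {p : ℕ} [Fact p.Prime] {P : Type*} [Group P] [Finite P]
    (hP : IsPGroup p P) {H : Subgroup P} (hH : IsCoatom H) :
    ∃ α : P →* Multiplicative (ZMod p), α.ker = H := by
  have := hP.isNilpotent
  have : H.Normal := Subgroup.NormalizerCondition.normal_of_coatom H
    Group.normalizerCondition_of_isNilpotent hH
  have : Nontrivial (P ⧸ H) := QuotientGroup.nontrivial_iff.mpr hH.1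
  have hQ : IsPGroup p (P ⧸ H) := hP.to_quotient H
  obtain ⟨x, hx⟩ := exists_prime_orderOf_dvd_card' p (hQ.card_eq_or_dvd.resolve_left
    Finite.one_lt_card.ne')
  -- The preimage of `⟨x⟩` strictly contains the maximal subgroup `H`.
  have htop : Subgroup.zpowers x = ⊤ := by
    have hlt : H < (Subgroup.zpowers x).comap (QuotientGroup.mk' H) := by
      refine lt_of_le_of_ne (fun y hy => ?_) fun heq => ?_
      · have : QuotientGroup.mk' H y = 1 := (QuotientGroup.eq_one_iff y).mpr hy
        rw [Subgroup.mem_comap, this]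
        exact one_mem _
      · obtain ⟨y, rfl⟩ := QuotientGroup.mk'_surjective H x
        have hy : y ∈ H := heq ▸ Subgroup.mem_zpowers _
        rw [show QuotientGroup.mk' H y = 1 from (QuotientGroup.eq_one_iff y).mpr hy,
          orderOf_one] at hx
        exact (Fact.out : p.Prime).one_lt.ne hx
    have := hH.2 _ hlt
    refine eq_top_iff.mpr fun z _ => ?_
    obtain ⟨y, rfl⟩ := QuotientGroup.mk'_surjective H z
    exact Subgroup.mem_comap.mp (this ▸ Subgroup.mem_top y)
  have hcard : Nat.card (P ⧸ H) = p := by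
    rw [← hx, ← Nat.card_zpowers, htop, Subgroup.card_top]
  let e : P ⧸ H ≃* Multiplicative (ZMod p) := mulEquivOfPrimeCardEq hcard (by simp)
  refine ⟨e.toMonoidHom.comp (QuotientGroup.mk' H), ?_⟩
  ext y
  simp

/-- A noncyclic finite group has two distinct maximal subgroups. -/
theorem exists_isCoatom_ne_of_not_isCyclic {G : Type*} [Group G] [Finite G] (hG : ¬ IsCyclic G) :
    ∃ H K : Subgroup G, IsCoatom H ∧ IsCoatom K ∧ H ≠ K := by
  have hmax (x : G) : ∃ H : Subgroup G, IsCoatom H ∧ x ∈ H := by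
    have hx : Subgroup.zpowers x ≠ ⊤ := fun h =>
      hG ⟨x, fun y => Subgroup.mem_zpowers_iff.mp (h.symm ▸ Subgroup.mem_top y)⟩
    obtain ⟨H, hH, hle⟩ := (eq_top_or_exists_le_coatom _).resolve_left hx
    exact ⟨H, hH, hle (Subgroup.mem_zpowers x)⟩
  obtain ⟨H, hH, -⟩ := hmax 1
  obtain ⟨x, hx⟩ : ∃ x, x ∉ H := by
    by_contra! hc
    exact hH.1 (eq_top_iff.mpr fun y _ => hc y)
  obtain ⟨K, hK, hxK⟩ := hmax x
  exact ⟨H, K, hH, hK, fun h => hx (h ▸ hxK)⟩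

/-- A noncyclic finite `p`-group has two linearly independent additive characters with values in a
field of characteristic `p`. -/
theorem IsPGroup.exists_independent_addChars {p : ℕ} [Fact p.Prime] (k : Type*) [Field k]
    [CharP k p] {P : Type*} [Group P] [Finite P] (hP : IsPGroup p P) (hc : ¬ IsCyclic P) :
    ∃ (α β : Additive P →+ k) (x y : P), α (.ofMul x) ≠ 0 ∧ β (.ofMul x) = 0 ∧
      α (.ofMul y) = 0 ∧ β (.ofMul y) ≠ 0 := by
  obtain ⟨H, K, hH, hK, hne⟩ := exists_isCoatom_ne_of_not_isCyclic hc
  obtain ⟨α, hα⟩ := hP.exists_ker_eq_of_isCoatom hH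
  obtain ⟨β, hβ⟩ := hP.exists_ker_eq_of_isCoatom hK
  obtain ⟨y, hyH, hyK⟩ := SetLike.not_le_iff_exists.mp fun hle : H ≤ K =>
    hne (hH.le_iff_eq hK.1 |>.mp hle).symm
  obtain ⟨x, hxK, hxH⟩ := SetLike.not_le_iff_exists.mp fun hle : K ≤ H =>
    hne (hK.le_iff_eq hH.1 |>.mp hle)
  let ι : ZMod p →+ k := (ZMod.castHom (dvd_refl p) k).toAddMonoidHom
  have hι : Function.Injective ι := (ZMod.castHom (dvd_refl p) k).injective
  have hval (γ : P →* Multiplicative (ZMod p)) (z : P) :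
      ι (MonoidHom.toAdditiveLeft γ (.ofMul z)) = 0 ↔ z ∈ γ.ker := by
    rw [map_eq_zero_iff ι hι]
    exact Iff.rfl
  refine ⟨ι.comp (MonoidHom.toAdditiveLeft α), ι.comp (MonoidHom.toAdditiveLeft β), x, y, ?_⟩
  simp only [AddMonoidHom.comp_apply, ne_eq, hval, hα, hβ]
  exact ⟨hxH, hxK, hyH, hyK⟩

/-! ### Unipotent planes -/

/-- A two-dimensional `kG`-module with basis `e₁, e₂` and coordinates `a, b`, on which `g` acts by
the unipotent matrix with off-diagonal entry `θ g`. -/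
structure IsUnipotentPlane {k : Type*} [Field k] {G : Type*} [Group G] {V : Type*} [AddCommGroup V]
    [Module k V] [Module (MonoidAlgebra k G) V] (θ : Additive G →+ k) (e₁ e₂ : V)
    (a b : Module.Dual k V) : Prop where
  eq_add (x : V) : x = a x • e₁ + b x • e₂
  fst_fst : a e₁ = 1
  fst_snd : a e₂ = 0
  snd_fst : b e₁ = 0
  snd_snd : b e₂ = 1
  single_smul (g : G) (x : V) :
    MonoidAlgebra.single g (1 : k) • x = x + (θ (.ofMul g) * b x) • e₁

/-- The representation `g ↦ 1 + θ g • N` on `k × k` (up to a universe lift), for an additive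
character `θ`, where `N` sends the second basis vector to the first one. -/
def unipotentRep {k : Type u} [Field k] {G : Type v} [Group G] (θ : Additive G →+ k) :
    Representation k G (ULift.{v} k × ULift.{v} k) where
  toFun g := 1 + θ (.ofMul g) • (LinearMap.inl k _ _ ∘ₗ LinearMap.snd k _ _)
  map_one' := by simp
  map_mul' g h := by
    ext x <;> simp [add_mul, add_comm]

theorem exists_isUnipotentPlane {k : Type u} [Field k] {G : Type v} [Group G]
    (θ : Additive G →+ k) :
    ∃ (V : Type (max u v)) (_ : AddCommGroup V) (_ : Module k V) (_ : Module (MonoidAlgebra k G) V)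
      (_ : IsScalarTower k (MonoidAlgebra k G) V) (e₁ e₂ : V) (a b : Module.Dual k V),
      IsUnipotentPlane θ e₁ e₂ a b := by
  let _ : Module (MonoidAlgebra k G) (ULift.{v} k × ULift.{v} k) :=
    Module.compHom _ (unipotentRep θ).asAlgebraHom.toRingHom
  have hsmul (r : MonoidAlgebra k G) (x : ULift.{v} k × ULift.{v} k) :
      r • x = (unipotentRep θ).asAlgebraHom r x := rfl
  refine ⟨ULift.{v} k × ULift.{v} k, inferInstance, inferInstance, inferInstance,
    ⟨fun c r x => by simp [hsmul]⟩, (1, 0), (0, 1),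
    ULift.moduleEquiv.toLinearMap ∘ₗ LinearMap.fst k _ _,
    ULift.moduleEquiv.toLinearMap ∘ₗ LinearMap.snd k _ _, ?_, rfl, rfl, rfl, rfl, ?_⟩
  · intro x
    ext <;> simp
  · intro g x
    rw [hsmul]
    ext <;> simp [unipotentRep]

namespace IsUnipotentPlane

variable {k : Type*} [Field k] {G : Type*} [Group G] {V : Type*} [AddCommGroup V] [Module k V]
  [Module (MonoidAlgebra k G) V] {θ : Additive G →+ k} {e₁ e₂ : V} {a b : Module.Dual k V}

theorem fst_ne_zero (h : IsUnipotentPlane θ e₁ e₂ a b) : e₁ ≠ 0 := fun h0 => by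
  simpa [h0] using h.fst_fst

variable [IsScalarTower k (MonoidAlgebra k G) V]

/-- A homomorphism of unipotent planes intertwines the nilpotent parts of the actions. -/
theorem hom_apply (h : IsUnipotentPlane θ e₁ e₂ a b) {V' : Type*} [AddCommGroup V'] [Module k V']
    [Module (MonoidAlgebra k G) V'] [IsScalarTower k (MonoidAlgebra k G) V']
    {η : Additive G →+ k} {e₁' e₂' : V'} {a' b' : Module.Dual k V'}
    (h' : IsUnipotentPlane η e₁' e₂' a' b') (f : V →ₗ[MonoidAlgebra k G] V') (g : Additive G) :
    θ g • f e₁ = η g • b' (f e₂) • e₁' := by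
  have hf := map_smul f (MonoidAlgebra.single g.toMul (1 : k)) e₂
  rw [h.single_smul, h'.single_smul, map_add, add_right_inj, h.snd_snd, mul_one, ofMul_toMul,
    mul_smul] at hf
  rw [← hf]
  exact ((f.restrictScalars k).map_smul _ _).symm

theorem end_apply_fst (h : IsUnipotentPlane θ e₁ e₂ a b) (hθ : θ ≠ 0)
    (f : Module.End (MonoidAlgebra k G) V) : f e₁ = b (f e₂) • e₁ := by
  obtain ⟨g, hg⟩ := DFunLike.ne_iff.mp hθ
  exact smul_right_injective V hg (h.hom_apply h f g)

theorem end_apply (h : IsUnipotentPlane θ e₁ e₂ a b) (hθ : θ ≠ 0)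
    (f : Module.End (MonoidAlgebra k G) V) (x : V) :
    f x = (a x * b (f e₂)) • e₁ + b x • f e₂ := by
  have hadd := (f.restrictScalars k).map_add (a x • e₁) (b x • e₂)
  rw [← h.eq_add x, map_smul, map_smul] at hadd
  simp only [LinearMap.restrictScalars_apply] at hadd
  rw [hadd, h.end_apply_fst hθ, mul_smul]

theorem end_ext (h : IsUnipotentPlane θ e₁ e₂ a b) (hθ : θ ≠ 0)
    {f f' : Module.End (MonoidAlgebra k G) V} (hf : f e₂ = f' e₂) : f = f' := by
  ext x
  rw [h.end_apply hθ f, h.end_apply hθ f', hf]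

/-- Each endomorphism is `t + sε`, with `s`, `t` the coordinates of its value at `e₂` and `ε : e₂ ↦
e₁`. -/
theorem end_mul_comm (h : IsUnipotentPlane θ e₁ e₂ a b) (hθ : θ ≠ 0)
    (f f' : Module.End (MonoidAlgebra k G) V) : f * f' = f' * f := by
  refine h.end_ext hθ ?_
  rw [Module.End.mul_apply, Module.End.mul_apply, h.end_apply hθ f (f' e₂),
    h.end_apply hθ f' (f e₂)]
  have hf := h.eq_add (f e₂)
  have hf' := h.eq_add (f' e₂)
  generalize a (f e₂) = s at *
  generalize b (f e₂) = t at *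
  generalize a (f' e₂) = s' at *
  generalize b (f' e₂) = t' at *
  rw [hf, hf']
  module

/-- The endomorphism of a unipotent plane sending the second basis vector to the first one. -/
noncomputable def nilpotentEnd (h : IsUnipotentPlane θ e₁ e₂ a b) :
    Module.End (MonoidAlgebra k G) V :=
  MonoidAlgebra.equivariantOfLinearOfComm (b.smulRight e₁) fun g x => by
    simp [h.single_smul, h.snd_fst]

theorem nilpotentEnd_apply (h : IsUnipotentPlane θ e₁ e₂ a b) (x : V) :
    h.nilpotentEnd x = b x • e₁ := rfl

theorem isIndecomposableModule (h : IsUnipotentPlane θ e₁ e₂ a b) (hθ : θ ≠ 0) :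
    IsIndecomposableModule (MonoidAlgebra k G) V := by
  obtain ⟨g, hg⟩ := DFunLike.ne_iff.mp hθ
  refine ⟨⟨e₁, 0, h.fst_ne_zero⟩, fun N₁ N₂ hN => ?_⟩
  -- The line `k e₁` is the socle: if `b x ≠ 0`, then `g x - x` is a nonzero multiple of `e₁`.
  have hmem (N : Submodule (MonoidAlgebra k G) V) (hN : N ≠ ⊥) : e₁ ∈ N := by
    obtain ⟨x, hx, hx0⟩ := N.exists_mem_ne_zero_of_ne_bot hN
    have hdown (c : k) (hc : c ≠ 0) (hy : c • e₁ ∈ N) : e₁ ∈ N := by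
      have := (N.restrictScalars k).smul_mem c⁻¹ hy
      rwa [inv_smul_smul₀ hc] at this
    by_cases hb : b x = 0
    · have hxa := h.eq_add x
      rw [hb, zero_smul, add_zero] at hxa
      refine hdown (a x) (fun ha => hx0 ?_) (hxa ▸ hx)
      rw [hxa, ha, zero_smul]
    · refine hdown (θ g * b x) (mul_ne_zero hg hb) ?_
      have := N.sub_mem (N.smul_mem (MonoidAlgebra.single g.toMul (1 : k)) hx) hx
      rwa [h.single_smul, add_sub_cancel_left] at this
  by_contra! hne
  exact h.fst_ne_zero <|
    Submodule.disjoint_def.mp hN.disjoint _ (hmem N₁ hne.1) (hmem N₂ hne.2)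

/-- The symmetrizing form takes the coefficient of `ε`; pairing with `1` and with `ε` recovers both
coordinates, and commutativity gives the bimodule identity. -/
theorem isSymmetricAlg_end (h : IsUnipotentPlane θ e₁ e₂ a b) (hθ : θ ≠ 0) :
    IsSymmetricAlg k (Module.End (MonoidAlgebra k G) V) := by
  let ev : Module.End (MonoidAlgebra k G) V →ₗ[k] k × k :=
    { toFun := fun f => (a (f e₂), b (f e₂))
      map_add' := fun _ _ => by simp
      map_smul' := fun _ _ => by simp }
  have hev (f f' : Module.End (MonoidAlgebra k G) V) (ha : a (f e₂) = a (f' e₂))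
      (hb : b (f e₂) = b (f' e₂)) : f = f' :=
    h.end_ext hθ (by rw [h.eq_add (f e₂), h.eq_add (f' e₂), ha, hb])
  have hfin : Module.Finite k (Module.End (MonoidAlgebra k G) V) :=
    Module.Finite.of_injective ev fun f f' hf =>
      hev f f' (congrArg Prod.fst hf) (congrArg Prod.snd hf)
  let φ : Module.End (MonoidAlgebra k G) V →ₗ[k]
      Module.Dual k (Module.End (MonoidAlgebra k G) V) :=
    (LinearMap.mul k _).compr₂ (LinearMap.fst k k k ∘ₗ ev)
  have hφ (f f' : Module.End (MonoidAlgebra k G) V) : φ f f' = a ((f * f') e₂) := rfl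
  have hinj : Function.Injective φ := fun f f' hff => by
    refine hev f f' (LinearMap.congr_fun hff 1) ?_
    have := LinearMap.congr_fun hff h.nilpotentEnd
    rw [hφ, hφ, h.end_mul_comm hθ, h.end_mul_comm hθ f', Module.End.mul_apply,
      Module.End.mul_apply, h.nilpotentEnd_apply, h.nilpotentEnd_apply] at this
    simpa [h.fst_fst] using this
  have hbij : Function.Bijective φ := ⟨hinj,
    (LinearMap.injective_iff_surjective_of_finrank_eq_finrank
      Subspace.dual_finrank_eq.symm).mp hinj⟩
  refine ⟨hfin, LinearEquiv.ofBijective φ hbij, fun x y z w => ?_⟩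
  change φ (x * z * y) w = φ z (y * w * x)
  rw [hφ, hφ, mul_assoc, mul_assoc,
    h.end_mul_comm hθ x, mul_assoc, mul_assoc]

theorem isIndecWithSymmetricEnd (h : IsUnipotentPlane θ e₁ e₂ a b) (hθ : θ ≠ 0) :
    IsIndecWithSymmetricEnd k G V where
  finite := by
    have hfin : Module.Finite k V := .of_injective (a.prod b) fun x y hxy => by
      rw [h.eq_add x, h.eq_add y, show a x = a y from congrArg Prod.fst hxy,
        show b x = b y from congrArg Prod.snd hxy]
    exact .of_restrictScalars_finite k _ _
  indecomposable := h.isIndecomposableModule hθ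
  symmetric_end := h.isSymmetricAlg_end hθ

/-- If the characters of isomorphic unipotent planes agree and do not vanish at one element, they
are equal. -/
theorem eq_of_linearEquiv (h : IsUnipotentPlane θ e₁ e₂ a b) {V' : Type*} [AddCommGroup V']
    [Module k V'] [Module (MonoidAlgebra k G) V'] [IsScalarTower k (MonoidAlgebra k G) V']
    {η : Additive G →+ k} {e₁' e₂' : V'} {a' b' : Module.Dual k V'}
    (h' : IsUnipotentPlane η e₁' e₂' a' b') (e : V ≃ₗ[MonoidAlgebra k G] V') {x : Additive G}
    (hx : θ x = η x) (hx0 : θ x ≠ 0) : θ = η := by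
  ext y
  have hxx := h.hom_apply h' e.toLinearMap x
  have hyy := h.hom_apply h' e.toLinearMap y
  rw [← hx] at hxx
  rw [← smul_right_injective V' hx0 hxx] at hyy
  exact smul_left_injective k ((LinearEquiv.map_ne_zero_iff e).mpr h.fst_ne_zero) hyy

end IsUnipotentPlane

theorem corollary5p4 (p : ℕ) [Fact p.Prime]
    (k : Type u) [Field k] [IsAlgClosed k] [CharP k p]
    (P : Type v) [Group P] [Finite P] (hP : IsPGroup p P) :
    (∀ (M : Type w) [AddCommGroup M] [Module k M] [Module (MonoidAlgebra k P) M]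
        [IsScalarTower k (MonoidAlgebra k P) M],
        IsIndecWithSymmetricEnd k P M → Module.rank k M ≤ (Nat.card P : Cardinal.{w})) ∧
    (¬ IsCyclic P →
      ∃ (M : ℕ → Type (max u v)) (_ : ∀ n, AddCommGroup (M n)) (_ : ∀ n, Module k (M n))
        (_ : ∀ n, Module (MonoidAlgebra k P) (M n))
        (_ : ∀ n, IsScalarTower k (MonoidAlgebra k P) (M n)),
        (∀ n, IsIndecWithSymmetricEnd k P (M n)) ∧
        ∀ m n, m ≠ n → IsEmpty (M m ≃ₗ[MonoidAlgebra k P] M n)) := by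
  refine ⟨fun M _ _ _ _ h => h.rank_le hP, fun hc => ?_⟩
  obtain ⟨α, β, x, y, hαx, hβx, hαy, hβy⟩ := hP.exists_independent_addChars k hc
  have : Infinite k := IsAlgClosed.instInfinite
  let c := Infinite.natEmbedding k
  -- All `θ n` take the same nonzero value at `x`, so proportional ones are equal; their values at
  -- `y` then separate them.
  let θ (n : ℕ) : Additive P →+ k := α + (AddMonoidHom.mulLeft (c n)).comp β
  have hθx (n : ℕ) : θ n (.ofMul x) = α (.ofMul x) := by simp [θ, hβx]
  have hθy (n : ℕ) : θ n (.ofMul y) = c n * β (.ofMul y) := by simp [θ, hαy]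
  have hθ (n : ℕ) : θ n ≠ 0 := fun h => hαx (by rw [← hθx n, h, AddMonoidHom.zero_apply])
  choose V _ _ _ _ e₁ e₂ a b hplane using fun n => exists_isUnipotentPlane (θ n)
  refine ⟨V, inferInstance, inferInstance, inferInstance, inferInstance,
    fun n => (hplane n).isIndecWithSymmetricEnd (hθ n), fun m n hmn => ⟨fun e => hmn ?_⟩⟩
  have := DFunLike.congr_fun ((hplane m).eq_of_linearEquiv (hplane n) e (x := .ofMul x)
    (by rw [hθx, hθx]) (by rwa [hθx])) (.ofMul y)
  rw [hθy, hθy] at this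
  exact c.injective (mul_right_cancel₀ hβy this)
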